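/- Let $G$ be a finite simple undirected graph with adjacency matrix $A(G)$ (a real symmetric $0$-$1$ matrix with zero diagonal). Eigenvalues are counted with multiplicity. Let $NPO(k)$ denote the smallest integer $n$ such that, for every graph $G$ on $n$ or more vertices, $A(G)$ has at least $k$ nonpositive eigenvalues (eigenvalues $\le 0$). Theorem. $NPO(4)=10$. That is, the adjacency matrix of every graph on at least $10$ vertices has at least $4$ nonpositive eigenvalues, and $10$ is the smallest number with this property. Moreover, each of the following two graphs $G_2$, $G_3$ on the $9$ vertices $0,1,\dots,8$ has an adjacency matrix with exactly $3$ nonpositive eigenvalues: - $G_2$ has the $15$ edges of the hexagon $0,1,2,3,4,5$ (in this cyclic order), of the triangle $6,7,8$, and the edges joining $6$ to $0$ and $3$, $7$ to $1$ and $4$, and $8$ to $2$ and $5$; - $G_3$ is obtained from $G_2$ by adding the edge $\{0,3\}$. -/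

import Mathlib

namespace SimpleGraph

open Classical in
/-- The real adjacency matrix of a finite simple graph is Hermitian (that is, symmetric). -/
theorem isHermitian_adjMatrix_real {V : Type*} [Fintype V] (G : SimpleGraph V) :
    (G.adjMatrix ℝ).IsHermitian := by
  rw [Matrix.IsHermitian, Matrix.conjTranspose_eq_transpose_of_trivial]
  exact G.transpose_adjMatrix

open Classical in
/-- The number of nonpositive eigenvalues of the adjacency matrix of `G`, counted with
multiplicity. -/
noncomputable def numNonposEigenvalues {V : Type*} [Fintype V] (G : SimpleGraph V) : ℕ :=
  (Finset.univ.filter fun i : V => G.isHermitian_adjMatrix_real.eigenvalues i ≤ 0).card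

/-- `NPO k` is the smallest `n` such that the adjacency matrix of every simple graph on `n` or
more vertices has at least `k` nonpositive eigenvalues. (The infimum in `ℕ` is the minimum if the
set is nonempty, and `0` if it is empty.) -/
noncomputable def NPO (k : ℕ) : ℕ :=
  sInf {n : ℕ | ∀ m : ℕ, n ≤ m → ∀ G : SimpleGraph (Fin m), k ≤ G.numNonposEigenvalues}

/-- A graph on 9 vertices with 15 edges: a hexagon `0,1,2,3,4,5` and a triangle `6,7,8`, where
`6`, `7`, `8` are joined to the three antipodal pairs `{0,3}`, `{1,4}`, `{2,5}`, respectively. -/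
def npoG₂ : SimpleGraph (Fin 9) :=
  fromEdgeSet {s(0, 1), s(1, 2), s(2, 3), s(3, 4), s(4, 5), s(5, 0),
    s(6, 7), s(7, 8), s(8, 6),
    s(6, 0), s(6, 3), s(7, 1), s(7, 4), s(8, 2), s(8, 5)}

/-- The graph `npoG₂` with the additional edge `{0,3}`; it has 9 vertices and 16 edges. -/
def npoG₃ : SimpleGraph (Fin 9) :=
  fromEdgeSet {s(0, 1), s(1, 2), s(2, 3), s(3, 4), s(4, 5), s(5, 0),
    s(6, 7), s(7, 8), s(8, 6),
    s(6, 0), s(6, 3), s(7, 1), s(7, 4), s(8, 2), s(8, 5), s(0, 3)}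

end SimpleGraph

/-! By Sylvester's law of inertia, the nonpositive eigenvalues can be counted on the adjacency form:
any subspace on which the form is nonpositive bounds their number below by its dimension
(`le_numNonposEigenvalues`), and any orthogonal basis without isotropic vectors gives the exact
number.

A graph on at least ten vertices contains four independent vertices or a triangle
(`exists_triangle_or_isIndepSet`). Independent vertices span a subspace on which the form vanishes,
which settles the first case. On a triangle the form has signature (1, 2). With fewer than four
nonpositive eigenvalues, the orthogonal complement of the triangle therefore contains no negative
semidefinite plane. The Gram matrix of the other vertices, projected to this complement, depends
only on their adjacencies to the triangle and to each other, so they can be enumerated one at a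
time. Forbidding planes spanned by two vectors of nonpositive norm, each a vertex or a sum or
difference of two, already leaves at most six further vertices (`search_seven`, made rigorous by
`card_lt_of_search`). That makes at most nine in all.

For sharpness, explicit integral orthogonal bases for the two graphs on nine vertices have exactly
three negative norms. -/

namespace SimpleGraph

/-! ### Inertia of the adjacency form. -/

open LinearMap (BilinForm)

/-- For an orthogonal basis, the signature is read off from the norms of the basis vectors. -/
theorem sigPos_of_orthogonal_basis {ι E : Type*} [Fintype ι] [AddCommGroup E] [Module ℝ E]
    (B : BilinForm ℝ E) (hB : B.IsSymm) (v : Module.Basis ι ℝ E) (hv : B.IsOrthoᵢ v) :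
    sigPos (LinearMap.BilinMap.toQuadraticMap B) = {i | 0 < B (v i) (v i)}.ncard := by
  let : Invertible (2 : ℝ) := invertibleOfNonzero two_ne_zero
  set Q := LinearMap.BilinMap.toQuadraticMap B with hQ
  have hassoc : QuadraticMap.associated (R := ℝ) Q = B :=
    QuadraticMap.associated_left_inverse ℝ hB.eq
  have hrepr := QuadraticMap.basisRepr_eq_of_iIsOrtho Q v (by rw [hassoc]; exact hv)
  have hequiv : QuadraticMap.Equivalent Q
      (QuadraticMap.weightedSumSquares ℝ fun i => Q (v i)) := by
    rw [← hrepr]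
    exact ⟨Q.isometryEquivBasisRepr v⟩
  rw [QuadraticForm.sigPos_of_equiv_weightedSumSquares hequiv]
  rfl

section

variable {V : Type*} [Fintype V]

open Classical in
/-- The bilinear form of the adjacency matrix. -/
noncomputable def adjForm (G : SimpleGraph V) : BilinForm ℝ (V → ℝ) :=
  Matrix.toLinearMap₂' ℝ (G.adjMatrix ℝ)

open Classical in
theorem adjForm_apply (G : SimpleGraph V) (x y : V → ℝ) :
    G.adjForm x y = x ⬝ᵥ (G.adjMatrix ℝ).mulVec y :=
  Matrix.toLinearMap₂'_apply' _ _ _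

open Classical in
theorem adjForm_isSymm (G : SimpleGraph V) : G.adjForm.IsSymm := by
  refine ⟨fun x y => ?_⟩
  rw [adjForm_apply, adjForm_apply, Matrix.dotProduct_mulVec,
    ← Matrix.mulVec_transpose, G.transpose_adjMatrix, dotProduct_comm]

/-- The orthonormal eigenvectors are also orthogonal for the adjacency form, with the eigenvalues as
norms. -/
theorem numNonposEigenvalues_add_sigPos (G : SimpleGraph V) :
    G.numNonposEigenvalues + sigPos (LinearMap.BilinMap.toQuadraticMap G.adjForm) =
      Fintype.card V := by
  classical
  have hA := G.isHermitian_adjMatrix_real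
  let v : Module.Basis V ℝ (V → ℝ) :=
    hA.eigenvectorBasis.toBasis.map (WithLp.linearEquiv 2 ℝ (V → ℝ))
  have hform : ∀ i j, G.adjForm (v i) (v j) = if i = j then hA.eigenvalues i else 0 := by
    intro i j
    have h1 := orthonormal_iff_ite.mp hA.eigenvectorBasis.orthonormal i j
    rw [EuclideanSpace.inner_eq_star_dotProduct, star_trivial, dotProduct_comm] at h1
    have h2 : G.adjForm (v i) (v j) = hA.eigenvalues j *
        ((hA.eigenvectorBasis i).ofLp ⬝ᵥ (hA.eigenvectorBasis j).ofLp) := by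
      have hv : ∀ i, v i = (hA.eigenvectorBasis i).ofLp := fun i => by simp [v]
      rw [adjForm_apply, hv, hv, hA.mulVec_eigenvectorBasis j, dotProduct_smul, smul_eq_mul]
    rw [h2, h1]
    split_ifs with h
    · rw [h, mul_one]
    · rw [mul_zero]
  rw [sigPos_of_orthogonal_basis _ G.adjForm_isSymm v fun i j hij =>
    (hform i j).trans (if_neg hij)]
  simp only [hform, if_true]
  rw [numNonposEigenvalues, ← Finset.card_univ,
    ← Finset.card_filter_add_card_filter_not (s := Finset.univ) fun i => hA.eigenvalues i ≤ 0,
    Set.ncard_eq_toFinset_card']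
  congr 2
  · ext; simp

/-- A subspace on which the adjacency form is nonpositive bounds `numNonposEigenvalues` below. -/
theorem le_numNonposEigenvalues {k : ℕ} (G : SimpleGraph V) (v : Fin k → V → ℝ)
    (hv : LinearIndependent ℝ v)
    (h : ∀ c : Fin k → ℝ, G.adjForm (∑ i, c i • v i) (∑ i, c i • v i) ≤ 0) :
    k ≤ G.numNonposEigenvalues := by
  have h1 := QuadraticForm.sigPos_add_finrank_le_of_nonpos
    (Q := LinearMap.BilinMap.toQuadraticMap G.adjForm) (V := Submodule.span ℝ (Set.range v)) (by
      intro x hx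
      obtain ⟨c, rfl⟩ := (Submodule.mem_span_range_iff_exists_fun ℝ).mp hx
      exact h c)
  rw [finrank_span_eq_card hv, Fintype.card_fin, Module.finrank_fintype_fun_eq_card,
    ← G.numNonposEigenvalues_add_sigPos] at h1
  omega

open Classical in
/-- The number of nonpositive eigenvalues is the number of nonpositive norms in an orthogonal
basis. -/
theorem numNonposEigenvalues_eq_of_orthogonal (G : SimpleGraph V) (v : V → V → ℝ) (d : V → ℝ)
    (h : ∀ i j, G.adjForm (v i) (v j) = if i = j then d i else 0) (hd : ∀ i, d i ≠ 0) :
    G.numNonposEigenvalues = (Finset.univ.filter fun i => d i ≤ 0).card := by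
  have hortho : G.adjForm.IsOrthoᵢ v := fun i j hij => (h i j).trans (if_neg hij)
  have hli : LinearIndependent ℝ v :=
    LinearMap.linearIndependent_of_isOrthoᵢ hortho fun i => by simpa [h] using hd i
  let b := basisOfLinearIndependentOfCardEqFinrank' v hli (by simp)
  have hb : ⇑b = v := by simp [b]
  have h1 := G.numNonposEigenvalues_add_sigPos
  rw [sigPos_of_orthogonal_basis _ G.adjForm_isSymm b (by rwa [hb]), hb] at h1
  simp only [h, if_true] at h1
  rw [← Finset.card_univ,
    ← Finset.card_filter_add_card_filter_not (s := Finset.univ) fun i => d i ≤ 0,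
    Set.ncard_eq_toFinset_card'] at h1
  have h2 : Set.toFinset {i | 0 < d i} = Finset.univ.filter fun i => ¬ d i ≤ 0 := by
    ext; simp
  rw [h2] at h1
  exact Nat.add_right_cancel h1

end

end SimpleGraph
-- The exhaustive search over vertices outside a triangle.
namespace SimpleGraph.TriangleSearch

/-- The combination of the entries of `l` with the signs in `c`, up to the shorter length. -/
def signedSum {M : Type*} [AddGroup M] : List SignType → List M → M
  | SignType.zero :: c, _ :: l => signedSum c l
  | SignType.pos :: c, x :: l => x + signedSum c l
  | SignType.neg :: c, x :: l => signedSum c l - x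
  | _, _ => 0

/-- An integer vector in the span of the vertices chosen so far: its norm, its coefficients, and
its products with these vertices, the latest first. -/
structure Vec where
  norm : ℤ
  coef : List SignType
  prods : List ℤ

/-- The adjacencies of a vertex to the three vertices of the base triangle. -/
abbrev Nbr := Bool × Bool × Bool

def Nbr.count (t : Nbr) : ℤ := t.1.toInt + t.2.1.toInt + t.2.2.toInt

/-- The product of the projections of two vertices to the orthogonal complement of the base
triangle, scaled by `4`; the vertices are adjacent if `a` is true. -/
def gram (s t : Nbr) (a : Bool) : ℤ :=
  4 * a.toInt + 4 * Nbr.count (s.1 && t.1, s.2.1 && t.2.1, s.2.2 && t.2.2) -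
    2 * (s.count * t.count)

/-- A vertex that may still be chosen: its adjacencies to the base triangle, and its products with
the vertices chosen so far. -/
structure Cand where
  nbr : Nbr
  row : List ℤ

def Cand.norm (w : Cand) : ℤ := gram w.nbr w.nbr false

/-- The vertices chosen so far, and the vectors of nonpositive norm among these vertices, their
sums and their differences. -/
structure State where
  basis : List Vec
  nonpos : List Vec

/-- A vector as seen after the choice of a vertex with products `r`. -/
def Vec.lift (r : List ℤ) (y : Vec) : Vec := ⟨y.norm, 0 :: y.coef, signedSum y.coef r :: y.prods⟩

def Cand.toVec (w : Cand) : Vec := ⟨w.norm, [1], w.norm :: w.row⟩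

/-- The sum and the difference of a new vertex and an old vector. -/
def Cand.combs (w : Cand) (e : Vec) : List Vec :=
  let d := signedSum e.coef w.row
  [⟨w.norm + 2 * d + e.norm, 1 :: e.coef, (w.norm + d) :: List.zipWith (· + ·) w.row e.prods⟩,
   ⟨w.norm - 2 * d + e.norm, 1 :: e.coef.map Neg.neg,
      (w.norm - d) :: List.zipWith (· - ·) w.row e.prods⟩]

/-- The vectors of nonpositive norm that come with a new vertex. -/
def State.new (S : State) (w : Cand) : List Vec :=
  (w.toVec :: S.basis.flatMap w.combs).filter fun x => x.norm ≤ 0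

/-- A new vector of nonpositive norm and an old one must not span a negative semidefinite plane. -/
def State.admits (S : State) (w : Cand) : Bool :=
  (S.new w).all fun x => S.nonpos.all fun y =>
    -- The head of `x.prods` is the product with the new vertex, which does not occur in `y`.
    let d := signedSum y.coef x.prods.tail
    decide (x.norm * y.norm < d * d)

def State.push (S : State) (w : Cand) : State :=
  ⟨w.toVec :: S.basis.map (Vec.lift w.row), S.new w ++ S.nonpos.map (Vec.lift w.row)⟩

def Cand.extend (h : Cand) (a : Bool) (w : Cand) : Cand := ⟨w.nbr, gram w.nbr h.nbr a :: w.row⟩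

/-- The candidates that remain when `h` is chosen. -/
def State.cands (S : State) (h : Cand) (C : List Cand) : List Cand :=
  C.flatMap fun w => [h.extend false w, h.extend true w].filter S.admits

/-- Whether an exhaustive search shows that fewer than `n` further vertices can be chosen. -/
def search : ℕ → State → List Cand → Bool
  | 0, _ => fun _ => false
  | n + 1, S => fun C => C.rec true fun h C ih =>
      -- Either some remaining vertex has type `h`, and it may be chosen next, or none has and `h`
      -- is dropped. In the first case `h` stays available, as other vertices may share this type.
      search n (S.push h) ((S.push h).cands h (h :: C)) && ih

def start : List Cand :=
  [true, false].flatMap fun a => [true, false].flatMap fun b => [true, false].map fun c =>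
    ⟨(a, b, c), []⟩

-- Seven is what remains of ten vertices outside the triangle; the search begins with all eight
-- adjacency patterns.
set_option maxRecDepth 100000 in
theorem search_seven : search 7 ⟨[], []⟩ start = true := by
  decide +kernel

section signedSum

variable {M N : Type*} [AddCommGroup M] [AddCommGroup N]

@[simp] theorem signedSum_nil_left (l : List M) : signedSum [] l = 0 := by
  cases l <;> rfl

@[simp] theorem signedSum_nil_right (c : List SignType) : signedSum c ([] : List M) = 0 := by
  rcases c with _ | ⟨_ | _ | _, c⟩ <;> rfl

theorem map_signedSum (φ : M →+ N) (c : List SignType) (l : List M) :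
    φ (signedSum c l) = signedSum c (l.map φ) := by
  induction c generalizing l with
  | nil => simp
  | cons s c ih =>
    cases l with
    | nil => simp
    | cons x l => rcases s with _ | _ | _ <;> simp [signedSum, ih]

theorem signedSum_map_neg (c : List SignType) (l : List M) :
    signedSum (c.map Neg.neg) l = -signedSum c l := by
  induction c generalizing l with
  | nil => simp
  | cons s c ih =>
    cases l with
    | nil => simp
    | cons x l =>
      rcases s with _ | _ | _
      · exact ih l
      · change x + signedSum (c.map Neg.neg) l = -(signedSum c l - x)
        rw [ih]; abel
      · change signedSum (c.map Neg.neg) l - x = -(x + signedSum c l)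
        rw [ih]; abel

theorem signedSum_mem {S : Type*} [SetLike S M] [AddSubgroupClass S M] (P : S)
    (c : List SignType) {l : List M} (h : ∀ x ∈ l, x ∈ P) : signedSum c l ∈ P := by
  induction c generalizing l with
  | nil => simp [zero_mem]
  | cons s c ih =>
    cases l with
    | nil => simp [zero_mem]
    | cons x l =>
      have hx := h x (by simp)
      have hl := ih fun y hy => h y (List.mem_cons_of_mem x hy)
      rcases s with _ | _ | _
      · exact hl
      · exact sub_mem hl hx
      · exact add_mem hx hl

end signedSum

end SimpleGraph.TriangleSearch
-- Soundness of the search.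
namespace SimpleGraph.TriangleSearch

section soundness

variable {α E : Type*} [AddCommGroup E] [Module ℝ E] (B : LinearMap.BilinForm ℝ E) (f : α → E)

/-- `y` describes the vector with its coefficients in the family `f` on `vs`. -/
structure Represents (vs : List α) (y : Vec) : Prop where
  ne_zero : signedSum y.coef (vs.map f) ≠ 0
  norm : B (signedSum y.coef (vs.map f)) (signedSum y.coef (vs.map f)) = y.norm
  prods : (vs.map fun v => B (signedSum y.coef (vs.map f)) (f v)) = y.prods.map Int.cast

variable {B f}

theorem apply_signedSum (x : E) (c : List SignType) {vs : List α} {l : List ℤ}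
    (h : (vs.map fun v => B x (f v)) = l.map Int.cast) :
    B x (signedSum c (vs.map f)) = (signedSum c l : ℤ) := by
  have h1 := map_signedSum (B x : E →ₗ[ℝ] ℝ).toAddMonoidHom c (vs.map f)
  have h2 := map_signedSum (Int.castAddHom ℝ) c l
  rw [List.map_map] at h1
  exact h1.trans ((congrArg _ h).trans h2.symm)

variable (B f) in
/-- The family `f` realizes the products that the search works with. -/
structure Realizes (nbr : α → Nbr) (adj : α → α → Bool) : Prop where
  symm : B.IsSymm
  irrefl : ∀ u, adj u u = false
  apply : ∀ u v, B (f u) (f v) = gram (nbr u) (nbr v) (adj u v)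
  linearIndependent : LinearIndependent ℝ f
  /-- There is no negative semidefinite plane. -/
  lt_sq : ∀ x ∈ Submodule.span ℝ (Set.range f), ∀ y ∈ Submodule.span ℝ (Set.range f),
    LinearIndependent ℝ ![x, y] → B x x ≤ 0 → B y y ≤ 0 → B x x * B y y < B x y * B x y

variable {nbr : α → Nbr} {adj : α → α → Bool}

/-- The candidate for the vertex `w` when the vertices `vs` have been chosen. -/
def cand (nbr : α → Nbr) (adj : α → α → Bool) (vs : List α) (w : α) : Cand :=
  ⟨nbr w, vs.map fun v => gram (nbr w) (nbr v) (adj w v)⟩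

namespace Realizes

theorem map_eq_zipWith {β : Type*} {F G : β → ℝ} {op : ℤ → ℤ → ℤ} {op' : ℝ → ℝ → ℝ}
    (hop : ∀ a b : ℤ, ((op a b : ℤ) : ℝ) = op' a b) {vs : List β} {r s : List ℤ}
    (hF : vs.map F = r.map Int.cast) (hG : vs.map G = s.map Int.cast) :
    (vs.map fun v => op' (F v) (G v)) = (List.zipWith op r s).map Int.cast := by
  induction vs generalizing r s with
  | nil =>
    rw [List.map_nil, eq_comm, List.map_eq_nil_iff] at hF
    simp [hF]
  | cons v vs ih =>
    obtain ⟨a, r, rfl, ha, hr⟩ := List.map_eq_cons_iff.mp hF.symm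
    obtain ⟨b, s, rfl, hb, hs⟩ := List.map_eq_cons_iff.mp hG.symm
    rw [List.map_cons, List.zipWith_cons_cons, List.map_cons, ih hr.symm hs.symm, hop, ha, hb]

theorem signedSum_mem_span (c : List SignType) (vs : List α) :
    signedSum c (vs.map f) ∈ Submodule.span ℝ (f '' {v | v ∈ vs}) := by
  refine signedSum_mem _ c fun x hx => ?_
  obtain ⟨v, hv, rfl⟩ := List.mem_map.mp hx
  exact Submodule.subset_span ⟨v, hv, rfl⟩

variable (R : Realizes B f nbr adj) {vs : List α} {w : α} {y : Vec} {S : State}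
include R

theorem map_apply (vs : List α) (w : α) :
    (vs.map fun v => B (f w) (f v)) = (cand nbr adj vs w).row.map Int.cast := by
  simp [cand, R.apply]

theorem norm_cand (vs : List α) (w : α) : B (f w) (f w) = (cand nbr adj vs w).norm := by
  simp [cand, Cand.norm, R.apply, R.irrefl]

theorem notMem_span (hw : w ∉ vs) : f w ∉ Submodule.span ℝ (f '' {v | v ∈ vs}) :=
  R.linearIndependent.notMem_span_image hw

theorem represents_lift (hy : Represents B f vs y) (w : α) :
    Represents B f (w :: vs) (y.lift (cand nbr adj vs w).row) where
  ne_zero := hy.ne_zero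
  norm := hy.norm
  prods := by
    have h := apply_signedSum (f w) y.coef (R.map_apply vs w)
    rw [R.symm.eq] at h
    exact congrArg₂ List.cons h hy.prods

theorem represents_toVec (vs : List α) (w : α) :
    Represents B f (w :: vs) (cand nbr adj vs w).toVec := by
  have h : signedSum (cand nbr adj vs w).toVec.coef ((w :: vs).map f) = f w := by
    change f w + signedSum [] (vs.map f) = f w
    simp
  refine ⟨?_, ?_, ?_⟩
  · rw [h]
    exact R.linearIndependent.ne_zero w
  · rw [h]
    exact R.norm_cand vs w
  · rw [h]
    exact congrArg₂ List.cons (R.norm_cand vs w) (R.map_apply vs w)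

theorem represents_combs (hy : Represents B f vs y) (hw : w ∉ vs) {x : Vec}
    (hx : x ∈ (cand nbr adj vs w).combs y) : Represents B f (w :: vs) x := by
  have hmem := signedSum_mem_span (f := f) y.coef vs
  have hd := apply_signedSum (f w) y.coef (R.map_apply vs w)
  have hd' := hd
  rw [R.symm.eq] at hd'
  have hn := R.norm_cand vs w
  have hrow := R.map_apply vs w
  have hprods := hy.prods
  have hnorm := hy.norm
  set z := signedSum y.coef (vs.map f)
  simp only [Cand.combs, List.mem_cons, List.not_mem_nil, or_false] at hx
  rcases hx with rfl | rfl
  · have h : signedSum (1 :: y.coef) ((w :: vs).map f) = f w + z := rfl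
    refine ⟨?_, ?_, ?_⟩
    · dsimp only
      rw [h]
      intro h0
      refine R.notMem_span hw ?_
      rw [eq_neg_of_add_eq_zero_left h0]
      exact neg_mem hmem
    · dsimp only
      rw [h]
      simp only [map_add, LinearMap.add_apply, hn, hd, hd', hnorm]
      push_cast; ring
    · dsimp only
      rw [h]
      simp only [List.map_cons, map_add, LinearMap.add_apply, hn, hd', List.cons.injEq]
      refine ⟨by push_cast; rfl, ?_⟩
      exact map_eq_zipWith (by intros; push_cast; rfl) hrow hprods
  · have h : signedSum (1 :: y.coef.map Neg.neg) ((w :: vs).map f) = f w - z := by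
      change f w + signedSum (y.coef.map Neg.neg) (vs.map f) = _
      rw [signedSum_map_neg, sub_eq_add_neg]
    refine ⟨?_, ?_, ?_⟩
    · dsimp only
      rw [h]
      intro h0
      refine R.notMem_span hw ?_
      rwa [sub_eq_zero.mp h0]
    · dsimp only
      rw [h]
      simp only [map_sub, LinearMap.sub_apply, hn, hd, hd', hnorm]
      push_cast; ring
    · dsimp only
      rw [h]
      simp only [List.map_cons, map_sub, LinearMap.sub_apply, hn, hd', List.cons.injEq]
      refine ⟨by push_cast; rfl, ?_⟩
      exact map_eq_zipWith (by intros; push_cast; rfl) hrow hprods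

end Realizes

variable (B f) in
/-- The state `S` describes vectors that are spanned by the vertices `vs`. -/
structure Valid (vs : List α) (S : State) : Prop where
  basis : ∀ y ∈ S.basis, Represents B f vs y
  nonpos : ∀ y ∈ S.nonpos, Represents B f vs y ∧ y.norm ≤ 0

namespace Realizes

variable (R : Realizes B f nbr adj) {vs : List α} {w : α} {y : Vec} {S : State}
include R

theorem represents_new (hS : Valid B f vs S) (hw : w ∉ vs) {x : Vec}
    (hx : x ∈ S.new (cand nbr adj vs w)) :
    (Represents B f (w :: vs) x ∧ x.norm ≤ 0) ∧ ∃ c, x.coef = 1 :: c := by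
  obtain ⟨hx, hx0⟩ := List.mem_filter.mp hx
  refine (and_right_comm.mp ⟨?_, of_decide_eq_true hx0⟩)
  rcases List.mem_cons.mp hx with rfl | hx
  · exact ⟨R.represents_toVec vs w, _, rfl⟩
  · obtain ⟨e, he, hx⟩ := List.mem_flatMap.mp hx
    refine ⟨R.represents_combs (hS.basis e he) hw hx, ?_⟩
    simp only [Cand.combs, List.mem_cons, List.not_mem_nil, or_false] at hx
    rcases hx with rfl | rfl <;> exact ⟨_, rfl⟩

theorem valid_push (hS : Valid B f vs S) (hw : w ∉ vs) :
    Valid B f (w :: vs) (S.push (cand nbr adj vs w)) where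
  basis y hy := by
    rcases List.mem_cons.mp hy with rfl | hy
    · exact R.represents_toVec vs w
    · obtain ⟨e, he, rfl⟩ := List.mem_map.mp hy
      exact R.represents_lift (hS.basis e he) w
  nonpos y hy := by
    rcases List.mem_append.mp hy with hy | hy
    · exact (R.represents_new hS hw hy).1
    · obtain ⟨e, he, rfl⟩ := List.mem_map.mp hy
      exact ⟨R.represents_lift (hS.nonpos e he).1 w, (hS.nonpos e he).2⟩

/-- A new vector involves `f w` with coefficient one and an old one lies in the span of the earlier
vertices, so the two are independent and `lt_sq` applies. -/
theorem admits_cand (hS : Valid B f vs S) (hw : w ∉ vs) : S.admits (cand nbr adj vs w) = true := by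
  refine List.all_eq_true.mpr fun x hx => List.all_eq_true.mpr fun y hy => decide_eq_true ?_
  obtain ⟨⟨hx, hx0⟩, c, hc⟩ := R.represents_new hS hw hx
  obtain ⟨hy, hy0⟩ := hS.nonpos y hy
  have hsub : Submodule.span ℝ (f '' {v | v ∈ vs}) ≤ Submodule.span ℝ (Set.range f) :=
    Submodule.span_mono (Set.image_subset_range _ _)
  have hyS := signedSum_mem_span (f := f) y.coef vs
  have hcS := signedSum_mem_span (f := f) c vs
  have hyz := hy.ne_zero
  have hyn := hy.norm
  have hxn := hx.norm
  have hxp := hx.prods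
  rw [hc] at hxn hxp
  have hxe : signedSum (1 :: c) ((w :: vs).map f) = f w + signedSum c (vs.map f) := rfl
  rw [hxe] at hxn hxp
  set z := signedSum c (vs.map f)
  set u := signedSum y.coef (vs.map f)
  have hp : (vs.map fun v => B (f w + z) (f v)) = x.prods.tail.map Int.cast := by
    rw [List.map_tail, ← hxp]; rfl
  have hxu := apply_signedSum (f w + z) y.coef hp
  have key := R.lt_sq (f w + z)
    (add_mem (Submodule.subset_span ⟨w, rfl⟩) (hsub hcS)) u (hsub hyS) ?_
    (by rw [hxn]; exact_mod_cast hx0) (by rw [hyn]; exact_mod_cast hy0)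
  · rw [hxn, hyn, hxu] at key
    exact_mod_cast key
  · rw [LinearIndependent.pair_iff]
    intro s t hst
    have hs : s = 0 := by
      by_contra hs
      refine R.notMem_span hw ?_
      have h1 : f w = -z - (s⁻¹ * t) • u := by
        have h2 : s⁻¹ • (s • (f w + z) + t • u) = 0 := by rw [hst, smul_zero]
        rw [smul_add, smul_smul, smul_smul, inv_mul_cancel₀ hs, one_smul] at h2
        rw [← sub_eq_zero, ← h2]
        abel
      rw [h1]
      exact sub_mem (neg_mem hcS) (Submodule.smul_mem _ _ hyS)
    refine ⟨hs, ?_⟩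
    rw [hs, zero_smul, zero_add] at hst
    exact (smul_eq_zero.mp hst).resolve_right hyz

/-- The two inductions follow the recursion of `search`: the outer one on the number of vertices,
the inner one on the candidate list. If a vertex of `T` has the first type, it is chosen and removed
from `T`; otherwise that type is discarded. -/
theorem card_lt_of_search {n : ℕ} {C : List Cand} (h : search n S C = true)
    (hS : Valid B f vs S) (T : Finset α) (hT : ∀ w ∈ T, w ∉ vs)
    (hC : ∀ w ∈ T, cand nbr adj vs w ∈ C) : T.card < n := by
  classical
  induction n generalizing vs S C T with
  | zero => exact absurd h Bool.false_ne_true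
  | succ n ihn =>
    induction C with
    | nil =>
      rw [Finset.eq_empty_of_forall_notMem fun w hw => List.not_mem_nil (hC w hw)]
      exact Nat.succ_pos n
    | cons a C ihC =>
      obtain ⟨h1, h2⟩ := Bool.and_eq_true_iff.mp
        (show (search n (S.push a) ((S.push a).cands a (a :: C)) && search (n + 1) S C) = true
          from h)
      by_cases hex : ∃ w ∈ T, cand nbr adj vs w = a
      · obtain ⟨w, hwT, rfl⟩ := hex
        have hw := hT w hwT
        have hpush := R.valid_push hS hw
        have hnot : ∀ u ∈ T.erase w, u ∉ w :: vs := fun u hu hmem =>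
          (List.mem_cons.mp hmem).elim (Finset.ne_of_mem_erase hu)
            (hT u (Finset.mem_of_mem_erase hu))
        have := ihn h1 hpush (T.erase w) hnot fun u hu => by
          refine List.mem_flatMap.mpr ⟨_, hC u (Finset.mem_of_mem_erase hu), ?_⟩
          have hext : cand nbr adj (w :: vs) u =
              (cand nbr adj vs w).extend (adj u w) (cand nbr adj vs u) := rfl
          refine List.mem_filter.mpr ⟨?_, R.admits_cand hpush (hnot u hu)⟩
          rw [hext]
          cases adj u w <;> simp
        rw [Finset.card_erase_of_mem hwT] at this
        omega
      · exact ihC h2 fun w hw => (List.mem_cons.mp (hC w hw)).resolve_left fun e => hex ⟨w, hw, e⟩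

theorem card_lt_seven [Fintype α] : Fintype.card α < 7 := by
  refine R.card_lt_of_search (vs := []) search_seven ⟨by simp, by simp⟩ Finset.univ (by simp) ?_
  intro w _
  have : ∀ t : Nbr, (⟨t, []⟩ : Cand) ∈ start := by
    rintro ⟨_ | _, _ | _, _ | _⟩ <;> simp [start]
  exact this (nbr w)

end Realizes

end soundness

end SimpleGraph.TriangleSearch
-- Independent sets and the Ramsey bound.
namespace SimpleGraph

variable {V : Type*} [Fintype V]

open Classical in
theorem adjForm_single (G : SimpleGraph V) (u v : V) :
    G.adjForm (Pi.single u 1) (Pi.single v 1) = ((decide (G.Adj u v)).toInt : ℝ) := by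
  rw [adjForm_apply, Matrix.mulVec_single_one, single_one_dotProduct, Matrix.col_apply,
    adjMatrix_apply]
  by_cases h : G.Adj u v <;> simp [h]

/-- An independent set bounds the number of nonpositive eigenvalues below. -/
theorem card_le_numNonposEigenvalues_of_isIndepSet (G : SimpleGraph V) (T : Finset V)
    (hT : G.IsIndepSet T) : T.card ≤ G.numNonposEigenvalues := by
  classical
  let s : Fin T.card → V := fun i => (T.equivFin.symm i : V)
  have hs : Function.Injective s := Subtype.val_injective.comp T.equivFin.symm.injective
  have h : ∀ i j, ¬ G.Adj (s i) (s j) := fun i j hij =>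
    hT (T.equivFin.symm i).2 (T.equivFin.symm j).2 hij.ne hij
  refine G.le_numNonposEigenvalues (fun i => Pi.single (s i) 1) ?_ fun c => ?_
  · have := (Pi.basisFun ℝ V).linearIndependent.comp s hs
    convert this using 2
    simp
  · refine le_of_eq ?_
    simp [map_sum, LinearMap.sum_apply, adjForm_single, h]

theorem isIndepSet_insert_of_forall {W : Type*} [DecidableEq W] {G : SimpleGraph W}
    {T : Finset W} (hT : G.IsIndepSet T) {v : W} (h : ∀ u ∈ T, ¬ G.Adj v u) :
    G.IsIndepSet (insert v T : Finset W) := by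
  rw [Finset.coe_insert]
  exact Set.Pairwise.insert hT fun u hu _ => ⟨h u hu, fun e => h u hu e.symm⟩

/-- The Ramsey bound `R(3, 4) ≤ 10`. -/
theorem exists_triangle_or_isIndepSet (G : SimpleGraph V) (hV : 10 ≤ Fintype.card V) :
    (∃ a b c, G.Adj a b ∧ G.Adj b c ∧ G.Adj a c) ∨
      ∃ T : Finset V, G.IsIndepSet T ∧ 4 ≤ T.card := by
  classical
  by_contra! hG
  obtain ⟨htri, hind⟩ := hG
  have hdeg (v : V) (T : Finset V) (hT : ∀ u ∈ T, G.Adj v u) : G.IsIndepSet T :=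
    fun a ha b hb _ hab => htri v a b (hT a ha) hab (hT b hb)
  obtain ⟨v⟩ : Nonempty V := Fintype.card_pos_iff.mp (by omega)
  have hv := hind _ (hdeg v {u | G.Adj v u} (by simp))
  let N : Finset V := {u | u ≠ v ∧ ¬ G.Adj v u}
  have hN : 6 ≤ N.card := by
    have h1 : (Finset.univ : Finset V) ⊆ insert v (N ∪ ({u | G.Adj v u} : Finset V)) := by
      intro u _
      simp only [N, Finset.mem_insert, Finset.mem_union, Finset.mem_filter_univ]
      tauto
    have h2 := Finset.card_le_card h1
    have h3 := Finset.card_insert_le v (N ∪ ({u | G.Adj v u} : Finset V))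
    have h4 := Finset.card_union_le N ({u | G.Adj v u} : Finset V)
    rw [Finset.card_univ] at h2
    omega
  have hNv : ∀ u ∈ N, u ≠ v ∧ ¬ G.Adj v u := fun u hu => (Finset.mem_filter_univ u).mp hu
  obtain ⟨u, hu⟩ := Finset.card_pos.mp (by omega : 0 < N.card)
  -- At least five other vertices of `N` split into neighbours and non-neighbours of `u`, so one
  -- class has three members. Three neighbours are independent and extend by `v`; among three
  -- non-neighbours, two are not adjacent and extend by `u` and `v`.
  have h5 := Finset.card_filter_add_card_filter_not (s := N.erase u) fun w => G.Adj u w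
  rw [Finset.card_erase_of_mem hu] at h5
  by_cases h6 : 3 ≤ ((N.erase u).filter fun w => G.Adj u w).card
  · set T := (N.erase u).filter fun w => G.Adj u w with hT
    have hTN : ∀ w ∈ T, w ∈ N := fun w hw => Finset.mem_of_mem_erase (Finset.mem_filter.mp hw).1
    have := hind (insert v T) (isIndepSet_insert_of_forall
      (hdeg u T fun w hw => (Finset.mem_filter.mp hw).2) fun w hw => (hNv w (hTN w hw)).2)
    rw [Finset.card_insert_of_notMem fun h => (hNv v (hTN v h)).1 rfl] at this
    omega
  · set T := (N.erase u).filter fun w => ¬ G.Adj u w with hT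
    have hTN : ∀ w ∈ T, (w ≠ u ∧ w ∈ N) ∧ ¬ G.Adj u w := fun w hw => by
      rw [hT, Finset.mem_filter, Finset.mem_erase] at hw
      exact hw
    obtain ⟨p, hp, q, hq, hpq, hadj⟩ : ∃ p ∈ T, ∃ q ∈ T, p ≠ q ∧ ¬ G.Adj p q := by
      by_contra! hall
      obtain ⟨a, b, c, ha, hb, hc, hab, hac, hbc⟩ :=
        Finset.two_lt_card_iff.mp (by omega : 2 < T.card)
      exact htri a b c (hall a ha b hb hab) (hall b hb c hc hbc) (hall a ha c hc hac)
    have hpN := hTN p hp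
    have hqN := hTN q hq
    have hpv := hNv p hpN.1.2
    have hqv := hNv q hqN.1.2
    have huv := hNv u hu
    have := hind {v, u, p, q} (isIndepSet_insert_of_forall (isIndepSet_insert_of_forall
      (isIndepSet_insert_of_forall (by simp [IsIndepSet]) (by simpa using hadj))
      (by simpa using ⟨hpN.2, hqN.2⟩)) (by simpa using ⟨huv.2, hpv.2, hqv.2⟩))
    rw [Finset.card_insert_of_notMem (by simp [huv.1.symm, hpv.1.symm, hqv.1.symm]),
      Finset.card_insert_of_notMem (by simp [hpN.1.1.symm, hqN.1.1.symm]),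
      Finset.card_pair hpq] at this
    omega

/-! ### Projection away from a triangle. -/

section triangle

open TriangleSearch

open Classical in
/-- The adjacencies of `v` to `a`, `b`, `c`. -/
noncomputable def nbrOf (G : SimpleGraph V) (a b c v : V) : Nbr :=
  (decide (G.Adj v a), decide (G.Adj v b), decide (G.Adj v c))

open Classical in
/-- Twice the projection of a vertex to the orthogonal complement of the triangle `a`, `b`, `c`. -/
noncomputable def triangleProj (G : SimpleGraph V) (a b c v : V) : V → ℝ :=
  -- The triangle has Gram matrix `J - I`, with inverse `J/2 - I`; doubling clears the denominator
  -- and gives the coefficients `count - 2 * t_i`.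
  let t := G.nbrOf a b c v
  (2 : ℝ) • Pi.single v 1 - ((t.count - 2 * t.1.toInt : ℤ) : ℝ) • Pi.single a 1
    - ((t.count - 2 * t.2.1.toInt : ℤ) : ℝ) • Pi.single b 1
    - ((t.count - 2 * t.2.2.toInt : ℤ) : ℝ) • Pi.single c 1

variable {G : SimpleGraph V} {a b c : V} (hab : G.Adj a b) (hbc : G.Adj b c) (hac : G.Adj a c)
include hab hbc hac

open Classical in
theorem adjForm_triangleProj (u v : V) :
    G.adjForm (G.triangleProj a b c u) (G.triangleProj a b c v) =
      gram (G.nbrOf a b c u) (G.nbrOf a b c v) (decide (G.Adj u v)) := by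
  have and_toInt : ∀ p q : Bool, (p && q).toInt = p.toInt * q.toInt := by decide
  simp only [triangleProj, gram, Nbr.count, nbrOf, map_sub, map_smul, LinearMap.sub_apply,
    LinearMap.smul_apply, adjForm_single, smul_eq_mul, and_toInt, hab, hbc, hac, hab.symm,
    hbc.symm, hac.symm, G.irrefl, decide_true, decide_false, Bool.toInt_true, Bool.toInt_false,
    G.adj_comm a v, G.adj_comm b v, G.adj_comm c v]
  push_cast
  ring

open Classical in
theorem adjForm_triangleProj_single (v : V) :
    G.adjForm (G.triangleProj a b c v) (Pi.single a 1) = 0 ∧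
    G.adjForm (G.triangleProj a b c v) (Pi.single b 1) = 0 ∧
    G.adjForm (G.triangleProj a b c v) (Pi.single c 1) = 0 := by
  simp only [triangleProj, Nbr.count, nbrOf, map_sub, map_smul, LinearMap.sub_apply,
    LinearMap.smul_apply, adjForm_single, smul_eq_mul, hab, hbc, hac, hab.symm,
    hbc.symm, hac.symm, G.irrefl, decide_true, decide_false, Bool.toInt_true, Bool.toInt_false]
  push_cast
  refine ⟨?_, ?_, ?_⟩ <;> ring

-- A negative semidefinite plane in the complement, together with the negative definite plane of the
-- triangle, would give four nonpositive eigenvalues.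
open Classical in
theorem realizes_triangleProj (hG : G.numNonposEigenvalues < 4) :
    Realizes G.adjForm (fun v : {v // v ≠ a ∧ v ≠ b ∧ v ≠ c} => G.triangleProj a b c v)
      (fun v => G.nbrOf a b c v) (fun u v => decide (G.Adj u v)) where
  symm := G.adjForm_isSymm
  irrefl u := by simp
  apply u v := adjForm_triangleProj hab hbc hac u v
  linearIndependent := by
    rw [Fintype.linearIndependent_iff]
    intro g hg w
    -- Outside the triangle, the projection of a vertex is supported at that vertex, with value 2.
    have h1 := congrFun hg w
    rw [Finset.sum_apply, Finset.sum_eq_single w] at h1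
    · simpa [triangleProj, w.2.1, w.2.2.1, w.2.2.2] using h1
    · intro v _ hv
      have : (w : V) ≠ v := fun e => hv (Subtype.ext e.symm)
      simp [triangleProj, w.2.1, w.2.2.1, w.2.2.2, this]
    · simp
  lt_sq := by
    intro x hx y hy hxy hx0 hy0
    by_contra! hle
    refine absurd hG (not_lt.mpr ?_)
    have horth : ∀ x ∈ Submodule.span ℝ (Set.range
        fun v : {v // v ≠ a ∧ v ≠ b ∧ v ≠ c} => G.triangleProj a b c v),
        G.adjForm x (Pi.single a 1) = 0 ∧ G.adjForm x (Pi.single b 1) = 0 ∧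
          G.adjForm x (Pi.single c 1) = 0 := by
      intro x hx
      induction hx using Submodule.span_induction with
      | mem x hx =>
        obtain ⟨v, rfl⟩ := hx
        exact adjForm_triangleProj_single hab hbc hac v
      | zero => simp
      | add x y _ _ hx hy => simp [hx, hy]
      | smul r x _ hx => simp [hx]
    obtain ⟨hxa, hxb, hxc⟩ := horth x hx
    obtain ⟨hya, hyb, hyc⟩ := horth y hy
    have hs := G.adjForm_isSymm.eq
    have hax := (hs (Pi.single a 1) x).trans hxa
    have hbx := (hs (Pi.single b 1) x).trans hxb
    have hcx := (hs (Pi.single c 1) x).trans hxc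
    have hay := (hs (Pi.single a 1) y).trans hya
    have hby := (hs (Pi.single b 1) y).trans hyb
    have hcy := (hs (Pi.single c 1) y).trans hyc
    have hyx := hs y x
    -- `p` and `q` are orthogonal eigenvectors of the triangle for the eigenvalue -1, of norms -2
    -- and -6.
    let p : V → ℝ := Pi.single a 1 - Pi.single b 1
    let q : V → ℝ := Pi.single a 1 + Pi.single b 1 - (2 : ℝ) • Pi.single c 1
    have hform : ∀ g : Fin 4 → ℝ, ∀ z, z = ∑ i, g i • ![p, q, x, y] i →
        G.adjForm z p = -2 * g 0 ∧ G.adjForm z q = -6 * g 1 ∧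
        G.adjForm z z = -2 * g 0 ^ 2 - 6 * g 1 ^ 2 + (g 2 ^ 2 * G.adjForm x x +
          2 * (g 2 * g 3) * G.adjForm x y + g 3 ^ 2 * G.adjForm y y) := by
      rintro g z rfl
      simp only [p, q, Fin.sum_univ_four, Matrix.cons_val, map_add, map_sub, map_smul,
        LinearMap.add_apply, LinearMap.sub_apply, LinearMap.smul_apply, smul_eq_mul,
        adjForm_single, hxa, hxb, hxc, hya, hyb, hyc, hax, hbx, hcx, hay, hby, hcy, hyx, hab, hbc,
        hac, hab.symm, hbc.symm, hac.symm, G.irrefl, decide_true, decide_false, Bool.toInt_true,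
        Bool.toInt_false]
      push_cast
      refine ⟨?_, ?_, ?_⟩ <;> ring
    refine G.le_numNonposEigenvalues ![p, q, x, y] ?_ fun g => ?_
    · rw [Fintype.linearIndependent_iff]
      intro g hg
      obtain ⟨h1, h2, -⟩ := hform g 0 hg.symm
      have g0 : g 0 = 0 := by simpa using h1
      have g1 : g 1 = 0 := by simpa using h2
      rw [LinearIndependent.pair_iff] at hxy
      obtain ⟨g2, g3⟩ := hxy (g 2) (g 3) (by simpa [Fin.sum_univ_four, g0, g1] using hg)
      intro i
      fin_cases i <;> assumption
    · obtain ⟨-, -, h3⟩ := hform g _ rfl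
      rw [h3]
      have : g 2 ^ 2 * G.adjForm x x + 2 * (g 2 * g 3) * G.adjForm x y +
          g 3 ^ 2 * G.adjForm y y ≤ 0 := by
        generalize G.adjForm x x = A at *
        generalize G.adjForm x y = B at *
        generalize G.adjForm y y = C at *
        -- If `A < 0`, complete the square; if `A = 0`, the determinant condition forces `B = 0`.
        rcases hx0.lt_or_eq with hA | rfl
        · have h4 : A * (g 2 ^ 2 * A + 2 * (g 2 * g 3) * B + g 3 ^ 2 * C) =
            (g 2 * A + g 3 * B) ^ 2 + g 3 ^ 2 * (A * C - B * B) := by ring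
          have h5 : 0 ≤ A * (g 2 ^ 2 * A + 2 * (g 2 * g 3) * B + g 3 ^ 2 * C) := by
            rw [h4]
            have := sub_nonneg.mpr hle
            positivity
          exact nonpos_of_mul_nonneg_right h5 hA
        · have hB : B = 0 := by nlinarith
          rw [hB]
          nlinarith [sq_nonneg (g 3)]
      nlinarith [sq_nonneg (g 0), sq_nonneg (g 1)]

end triangle

/-! ### The bound for ten vertices and the two graphs on nine. -/

/-- Every graph on at least ten vertices has at least four nonpositive eigenvalues. -/
theorem four_le_numNonposEigenvalues (G : SimpleGraph V) (hV : 10 ≤ Fintype.card V) :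
    4 ≤ G.numNonposEigenvalues := by
  classical
  rcases G.exists_triangle_or_isIndepSet hV with ⟨a, b, c, hab, hbc, hac⟩ | ⟨T, hT, hT4⟩
  · by_contra! hG
    have h1 := (realizes_triangleProj hab hbc hac hG).card_lt_seven
    have h2 : Fintype.card {v // v ≠ a ∧ v ≠ b ∧ v ≠ c} + ({a, b, c} : Finset V).card =
        Fintype.card V := by
      rw [Fintype.card_subtype, ← Finset.card_univ,
        ← Finset.card_filter_add_card_filter_not (s := Finset.univ)
          fun v => v ≠ a ∧ v ≠ b ∧ v ≠ c]
      congr 2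
      ext v
      simp only [Finset.mem_insert, Finset.mem_singleton, Finset.mem_filter_univ]
      tauto
    have h3 := Finset.card_le_three (a := a) (b := b) (c := c)
    omega
  · exact hT4.trans (G.card_le_numNonposEigenvalues_of_isIndepSet T hT)

/-- If the rows of an integer matrix are orthogonal for the adjacency form, with nonzero norms, then
the number of nonpositive eigenvalues is the number of negative norms. -/
theorem numNonposEigenvalues_eq_of_integer_diagonalization {n : ℕ} (G : SimpleGraph (Fin n))
    [DecidableRel G.Adj] (P : Matrix (Fin n) (Fin n) ℤ) (d : Fin n → ℤ)
    (h : ∀ i j, (∑ k, ∑ l, if G.Adj k l then P i k * P j l else 0) = if i = j then d i else 0)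
    (hd : ∀ i, d i ≠ 0) :
    G.numNonposEigenvalues = (Finset.univ.filter fun i => d i ≤ 0).card := by
  classical
  rw [G.numNonposEigenvalues_eq_of_orthogonal (fun i k => (P i k : ℝ)) (fun i => (d i : ℝ)) ?_
    fun i => by exact_mod_cast hd i]
  · congr 1
    ext i
    simp
  · intro i j
    have := congrArg (Int.cast : ℤ → ℝ) (h i j)
    push_cast at this
    refine Eq.trans ?_ (this.trans (by congr))
    rw [adjForm_apply]
    simp only [dotProduct, Matrix.mulVec, Finset.mul_sum, adjMatrix_apply]
    refine Finset.sum_congr rfl fun k _ => Finset.sum_congr rfl fun l _ => ?_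
    by_cases hkl : G.Adj k l <;> simp [hkl]

instance : DecidableRel npoG₂.Adj := fun i j => decidable_of_iff
  (s(i, j) ∈ ({s(0, 1), s(1, 2), s(2, 3), s(3, 4), s(4, 5), s(5, 0), s(6, 7), s(7, 8), s(8, 6),
    s(6, 0), s(6, 3), s(7, 1), s(7, 4), s(8, 2), s(8, 5)} : Finset (Sym2 (Fin 9))) ∧ i ≠ j)
  (by rw [npoG₂, fromEdgeSet_adj, ← Finset.mem_coe]; push_cast; rfl)

instance : DecidableRel npoG₃.Adj := fun i j => decidable_of_iff
  (s(i, j) ∈ ({s(0, 1), s(1, 2), s(2, 3), s(3, 4), s(4, 5), s(5, 0), s(6, 7), s(7, 8), s(8, 6),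
    s(6, 0), s(6, 3), s(7, 1), s(7, 4), s(8, 2), s(8, 5), s(0, 3)} : Finset (Sym2 (Fin 9))) ∧
    i ≠ j)
  (by rw [npoG₃, fromEdgeSet_adj, ← Finset.mem_coe]; push_cast; rfl)

theorem numNonposEigenvalues_npoG₂ : npoG₂.numNonposEigenvalues = 3 :=
  (numNonposEigenvalues_eq_of_integer_diagonalization npoG₂
    -- The first three rows diagonalize the form on the triangle 6, 7, 8, and the fourth is twice
    -- the projection of vertex 0 to its complement; the other rows complete an orthogonal basis.
    !![0, 0, 0, 0, 0, 0, 1, 1, 0;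
       0, 0, 0, 0, 0, 0, 1, -1, 0;
       0, 0, 0, 0, 0, 0, -1, -1, 1;
       2, 0, 0, 0, 0, 0, 1, -1, -1;
       0, 1, 1, 0, 0, 0, -1, 0, 0;
       -2, 1, -1, 0, 0, 0, -1, 2, 0;
       1, -1, 1, 1, 0, 0, 1, -2, 0;
       -1, 1, -1, 1, 2, 0, -1, 2, -2;
       1, -1, 1, -1, 1, 3, -2, -2, 2]
    ![2, -2, -2, 2, 2, -2, 2, 6, 12] (by decide +kernel) (by decide)).trans (by decide)

theorem numNonposEigenvalues_npoG₃ : npoG₃.numNonposEigenvalues = 3 :=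
  (numNonposEigenvalues_eq_of_integer_diagonalization npoG₃
    !![0, 0, 0, 0, 0, 0, 1, 1, 0;
       0, 0, 0, 0, 0, 0, 1, -1, 0;
       0, 0, 0, 0, 0, 0, -1, -1, 1;
       2, 0, 0, 0, 0, 0, 1, -1, -1;
       -3, 0, 0, 1, 0, 0, -1, 1, 1;
       1, 2, 0, -1, 0, 0, -1, 1, -1;
       -1, 0, 2, 1, 0, 0, -1, -1, 1;
       -1, 0, 0, 1, 2, 0, -1, 1, -1;
       1, 0, 0, -1, 0, 2, -1, -1, 1]
    ![2, -2, -2, 2, -4, 4, 4, 4, 4] (by decide +kernel) (by decide)).trans (by decide)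

end SimpleGraph
theorem theorem4p5 :
    SimpleGraph.NPO 4 = 10 ∧
    (∀ (V : Type*) [Fintype V] (G : SimpleGraph V),
      10 ≤ Fintype.card V → 4 ≤ G.numNonposEigenvalues) ∧
    SimpleGraph.npoG₂.numNonposEigenvalues = 3 ∧
    SimpleGraph.npoG₃.numNonposEigenvalues = 3 := by
  refine ⟨?_, fun V _ G => G.four_le_numNonposEigenvalues,
    SimpleGraph.numNonposEigenvalues_npoG₂, SimpleGraph.numNonposEigenvalues_npoG₃⟩
  have hmem : 10 ∈ {n : ℕ | ∀ m : ℕ, n ≤ m → ∀ G : SimpleGraph (Fin m),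
      4 ≤ G.numNonposEigenvalues} := fun m hm G =>
    G.four_le_numNonposEigenvalues (by rwa [Fintype.card_fin])
  refine le_antisymm (Nat.sInf_le hmem) (le_csInf ⟨10, hmem⟩ fun n hn => ?_)
  by_contra! hlt
  have := hn 9 (by omega) SimpleGraph.npoG₂
  rw [SimpleGraph.numNonposEigenvalues_npoG₂] at this
  omega
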